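/- Let $A=\mathbb F_q[\theta]$, let $K$ be its fraction field, let $A^+(i)$ be the set of monic polynomials of degree $i$ in $A$, and let $Y,t_1,\dots,t_s$ be indeterminates. For $a\in A$ write $a(t_j)$ for the polynomial obtained from $a$ by substituting $t_j$ for $\theta$. Put $$F_d(1;s)=\sum_{i=0}^{d-1}\ \sum_{a\in A^+(i)}\frac{a(t_1)\cdots a(t_s)}{a}\in K[t_1,\dots,t_s]\quad(d\ge 1),$$ $$l_d=\prod_{i=1}^{d}(\theta-\theta^{q^i}),\qquad b_i(Y)=\prod_{j=0}^{i-1}(Y-\theta^{q^j}),\qquad l_0=b_0=1.$$ Let $s\ge 1$ be an integer with $s\equiv 1\pmod{q-1}$, let $m=\frac{s-1}{q-1}$, and put $$\Pi_{s,d}=\frac{b_{d-m}(t_1)\cdots b_{d-m}(t_s)}{l_{d-1}}\in K[t_1,\dots,t_s]\quad(d\ge\max\{1,m\}).$$ **Theorem.** There exists a nonzero rational fraction $\mathbb H_s\in K(Y,t_1,\dots,t_s)$ such that, for all $d\ge\max\{1,m\}$, $\mathbb H_s$ is regular along $Y=\theta^{q^{d-m}}$ and $$F_d(1;s)=\Pi_{s,d}\cdot\mathbb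 H_s|_{Y=\theta^{q^{d-m}}}.\qquad(*)$$ If $s=1$, this holds with $\mathbb H_1=\frac{1}{t_1-\theta}$. If $m>0$, then $\mathbb H_s$ can be taken to be a polynomial in $A[Y,t_1,\dots,t_s]$ with $\deg_{t_i}(\mathbb H_s)=m-1$ for all $i=1,\dots,s$ and $\deg_Y(\mathbb H_s)=\frac{q^m-1}{q-1}-m$; it is the only polynomial in $A[Y,t_1,\dots,t_s]$ that satisfies $(*)$ for all $d\ge\max\{1,m\}$. -/

import Mathlib

open Polynomial

noncomputable section

namespace HarmonicSums

variable (F : Type*) [Field F] [Fintype F]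

/-! Throughout, `F` is the finite field with `q = Fintype.card F` elements, `F[X]` is the ring `A`
(its variable `X` is `θ`) and `RatFunc F` is the field of fractions `K` of `A`. -/

/-- The ring `K[t_1, …, t_s]`. -/
abbrev KT (s : ℕ) := MvPolynomial (Fin s) (RatFunc F)

/-- The field `K(t_1, …, t_s)`. -/
abbrev KTFrac (s : ℕ) := FractionRing (KT F s)

/-- The ring `A[Y, t_1, …, t_s]`; `none` is the index of `Y`, and `some i` that of `t_i`. -/
abbrev AYT (s : ℕ) := MvPolynomial (Option (Fin s)) F[X]

/-- The ring `K[Y, t_1, …, t_s]`; `none` is the index of `Y`, and `some i` that of `t_i`. -/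
abbrev KYT (s : ℕ) := MvPolynomial (Option (Fin s)) (RatFunc F)

/-- The field `K(Y, t_1, …, t_s)`. -/
abbrev KYTFrac (s : ℕ) := FractionRing (KYT F s)

/-- The set `A⁺(d)` of monic polynomials of degree `d` is finite. -/
theorem finite_monic (d : ℕ) : {a : F[X] | a.Monic ∧ a.natDegree = d}.Finite := by
  have hinj : Set.InjOn (fun (a : F[X]) (i : Fin (d + 1)) => a.coeff i)
      {a : F[X] | a.Monic ∧ a.natDegree = d} := by
    rintro a ⟨-, ha⟩ b ⟨-, hb⟩ hab
    ext n
    by_cases hn : n < d + 1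
    · exact congrFun hab ⟨n, hn⟩
    · rw [coeff_eq_zero_of_natDegree_lt (by omega), coeff_eq_zero_of_natDegree_lt (by omega)]
  exact Set.Finite.of_finite_image (Set.toFinite _) hinj

/-- `A⁺(d)`, the monic polynomials of degree `d` in `A`. -/
def monicOfDegree (d : ℕ) : Finset F[X] := (finite_monic F d).toFinset

/-- The twisted power sum `S_d(n;s) = ∑_{a ∈ A⁺(d)} a(t_1) ⋯ a(t_s) / a^n` in `K[t_1, …, t_s]`. -/
def powerSum (d : ℕ) (n : ℤ) (s : ℕ) : KT F s :=
  ∑ a ∈ monicOfDegree F d,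
    MvPolynomial.C ((algebraMap F[X] (RatFunc F) a ^ n)⁻¹) *
      ∏ i : Fin s, aeval (MvPolynomial.X i : KT F s) a

/-- The twisted `A`-harmonic sum `F_d(n;s) = ∑_{i=0}^{d-1} S_i(n;s)`. -/
def harmonicSum (d : ℕ) (n : ℤ) (s : ℕ) : KT F s :=
  ∑ i ∈ Finset.range d, powerSum F i n s

/-- `l_d = (θ - θ^q)(θ - θ^{q^2}) ⋯ (θ - θ^{q^d})`, with `l_0 = 1`. -/
def l (d : ℕ) : F[X] := ∏ i ∈ Finset.range d, (X - X ^ Fintype.card F ^ (i + 1))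

/-- `b_i(Y) = (Y - θ)(Y - θ^q) ⋯ (Y - θ^{q^{i-1}})` in `A[Y]`, with `b_0 = 1`. -/
def b (i : ℕ) : F[X][X] := ∏ j ∈ Finset.range i, (X - C (X ^ Fintype.card F ^ j))

/-- The integer `m = ⌊(s-1)/(q-1)⌋` (for `s ≥ 1`). -/
def m (s : ℕ) : ℕ := (s - 1) / (Fintype.card F - 1)

/-- `Π_{s,d} = b_{d-m}(t_1) ⋯ b_{d-m}(t_s) / l_{d-1}` in `K[t_1, …, t_s]`, for `d ≥ max(1, m)`. -/
def bigPi (s d : ℕ) : KT F s :=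
  MvPolynomial.C ((algebraMap F[X] (RatFunc F) (l F (d - 1)))⁻¹) *
    ∏ i : Fin s, aeval (MvPolynomial.X i : KT F s) (b F (d - m F s))

variable {F}

/-- The substitution `Y = c` in a polynomial of `K[Y, t_1, …, t_s]`, for `c ∈ K`. -/
def substY {s : ℕ} (c : RatFunc F) : KYT F s →ₐ[RatFunc F] KT F s :=
  MvPolynomial.aeval (fun o => o.elim (MvPolynomial.C c) MvPolynomial.X)

/-- The rational fraction `H ∈ K(Y, t_1, …, t_s)` is regular along `Y = c` (it can be written with
a denominator that does not vanish identically under `Y = c`), and `H|_{Y = c} = v`. -/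
def HasValueAt {s : ℕ} (H : KYTFrac F s) (c : RatFunc F) (v : KTFrac F s) : Prop :=
  ∃ N D : KYT F s, substY c D ≠ 0 ∧
    H = algebraMap (KYT F s) (KYTFrac F s) N / algebraMap (KYT F s) (KYTFrac F s) D ∧
    v = algebraMap (KT F s) (KTFrac F s) (substY c N) /
      algebraMap (KT F s) (KTFrac F s) (substY c D)

/-- For all `d ≥ max(1, m)`: `H` is regular along `Y = θ^{q^{d-m}}`, and
`F_d(1;s) = Π_{s,d} · H|_{Y = θ^{q^{d-m}}}` in `K(t_1, …, t_s)`. -/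
def Interpolates {s : ℕ} (H : KYTFrac F s) : Prop :=
  ∀ d : ℕ, 1 ≤ d → m F s ≤ d →
    ∃ v : KTFrac F s, HasValueAt H (RatFunc.X ^ Fintype.card F ^ (d - m F s)) v ∧
      algebraMap (KT F s) (KTFrac F s) (harmonicSum F d 1 s) =
        algebraMap (KT F s) (KTFrac F s) (bigPi F s d) * v

/-- A polynomial of `A[Y, t_1, …, t_s]`, seen as an element of `K(Y, t_1, …, t_s)`. -/
def toFrac {s : ℕ} (P : AYT F s) : KYTFrac F s :=
  algebraMap (KYT F s) (KYTFrac F s) (MvPolynomial.map (algebraMap F[X] (RatFunc F)) P)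

end HarmonicSums

end

/-!
The proof rests on the expansion `a(t) = ∑_j E_j(a) b_j(t)` (`map_eq_sum_carlitzE`), where the
Carlitz polynomials `E_j` are defined by `E_0 = z` and
`E_j^q = E_j + (θ^{q^{j+1}} - θ) E_{j+1}`, and `E_j(a) = 0` for `deg a < j`. Multiplying these
expansions out, `F_d(1;s)` becomes the sum of `Λ_d(E_{j_1} ⋯ E_{j_s}) ∏ b_{j_i}(t_i)` over indices
`j_i < d`, with `Λ_d(f) = ∑ f(a)/a` over the monic `a` of degree `< d`. For products of
`s ≡ 1 (mod q - 1)` factors, `Λ_d` is minus the sum over all nonzero `a` of degree `< d`. Lagrange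
interpolation on this additive group shows that `Λ_d(g)` is the coefficient of `z` in `g` whenever
`deg g < q^d` and `g(0) = 0`. So `Λ_d(E_j) = 1/l_j`, while `Λ_d` kills every product of at least two
factors in which no `E_j` occurs `q` times.

All other products reduce to these through the relation for `E_j^q`, each step of which removes
`q - 1` factors. An induction on the number of steps gives two facts. If some `j_i < d - m`, and
`m ≥ 1`, the two terms of the last reduction cancel, and `Λ_d(E_{j_1} ⋯ E_{j_s}) = 0`
(`carlitzSum_eq_zero_of_add_lt`). If `j_i = d - m + k_i`, then the coefficients
`θ^{q^{d-m+k+1}} - θ` and the final values `l_{d-1}/l_{d-m+k}` are polynomials in `θ` and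
`Y = θ^{q^{d-m}}`, independent of `d`, so that `l_{d-1} Λ_d(∏ E_{d-m+k_i})` is the value at this `Y`
of a fixed `W_k ∈ A[Y]` (`exists_interpolate_carlitzSum`). Since
`b_{d-m+k}(t) = b_{d-m}(t) ∏_{u<k} (t - Y^{q^u})`, the sum of the
`W_k(Y) ∏_i ∏_{u<k_i} (t_i - Y^{q^u})` over the `k` with all `k_i < m` is the polynomial sought. For
`m = 0`, that is `s = 1`, the sum `∑_{j<d} b_j(t)/l_j` telescopes instead.

Its degree in `t_i` is at most `m - 1` by construction. It is equal to `m - 1` because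
`∏ t_i^{m-1}` has the coefficient `1/l_{m-1}` in `F_m(1;s)`. Its degree in `Y` is found from sizes
at the infinite place of `K`: after a specialisation `t_i = θ^{-n_i}` with `n_i ≥ 1`, the term of
`a = 1` dominates `F_d(1;s)`, whose size is therefore `1` for all `d`, and the sizes of the factors
`b_{d-m}(t_i)` and of `l_{d-1}` are explicit (`degreeOf_none_interpolant`). Uniqueness holds because
the values `θ^{q^e}` of `Y` are infinitely many.
-/

noncomputable section

namespace HarmonicSums

/-! ### Carlitz polynomials and the expansion of `a(t)` in the basis `b_j(t)` -/

section

theorem ratFuncX_pow_injective (F : Type*) [Field F] :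
    Function.Injective fun n : ℕ => (RatFunc.X : RatFunc F) ^ n := by
  intro i j h
  have h' : (X : F[X]) ^ i = X ^ j := by
    apply RatFunc.algebraMap_injective F
    simpa [RatFunc.algebraMap_X] using h
  simpa using congrArg natDegree h'

variable (F : Type*) [Field F] [Fintype F]

theorem ratFuncX_pow_card_injective :
    Function.Injective fun n : ℕ => (RatFunc.X : RatFunc F) ^ Fintype.card F ^ n :=
  (ratFuncX_pow_injective F).comp (Nat.pow_right_injective Fintype.one_lt_card)

theorem ratFuncX_pow_card_sub_ne_zero (j : ℕ) :
    (RatFunc.X : RatFunc F) ^ Fintype.card F ^ (j + 1) - RatFunc.X ≠ 0 := by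
  intro h
  have := @ratFuncX_pow_card_injective F _ _ (j + 1) 0 (by simpa [sub_eq_zero] using h)
  omega

variable {F} in
theorem card_pow_sum {R ι : Type*} [CommRing R] [Algebra F R] (s : Finset ι) (f : ι → R) :
    (∑ i ∈ s, f i) ^ Fintype.card F = ∑ i ∈ s, f i ^ Fintype.card F :=
  map_sum (FiniteField.frobeniusAlgHom F R) f s

/-- The Carlitz polynomials `E_j ∈ K[z]`, here given by the recursion
`E_0 = z`, `(θ^{q^{j+1}} - θ) E_{j+1} = E_j^q - E_j`. -/
def carlitzE : ℕ → (RatFunc F)[X]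
  | 0 => X
  | j + 1 => C ((RatFunc.X ^ Fintype.card F ^ (j + 1) - RatFunc.X)⁻¹) *
      (carlitzE j ^ Fintype.card F - carlitzE j)

theorem carlitzE_pow_card (j : ℕ) :
    carlitzE F j ^ Fintype.card F =
      carlitzE F j + C (RatFunc.X ^ Fintype.card F ^ (j + 1) - RatFunc.X) * carlitzE F (j + 1) := by
  rw [carlitzE, ← mul_assoc, ← C_mul, mul_inv_cancel₀ (ratFuncX_pow_card_sub_ne_zero F j)]
  simp

theorem natDegree_carlitzE_le (j : ℕ) : (carlitzE F j).natDegree ≤ Fintype.card F ^ j := by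
  induction j with
  | zero => simp [carlitzE]
  | succ j ih =>
    rw [carlitzE]
    refine (natDegree_C_mul_le _ _).trans ((natDegree_sub_le _ _).trans (max_le ?_ ?_))
    · refine natDegree_pow_le.trans ?_
      rw [pow_succ']
      gcongr
    · exact ih.trans (Nat.pow_le_pow_right Fintype.card_pos (Nat.le_succ j))

theorem X_dvd_carlitzE (j : ℕ) : X ∣ carlitzE F j := by
  induction j with
  | zero => simp [carlitzE]
  | succ j ih =>
    rw [carlitzE]
    exact ((ih.trans (dvd_pow_self _ Fintype.card_ne_zero)).sub ih).mul_left _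

theorem l_succ (d : ℕ) : l F (d + 1) = l F d * (X - X ^ Fintype.card F ^ (d + 1)) := by
  rw [l, l, Finset.prod_range_succ]

theorem algebraMap_l (d : ℕ) : algebraMap F[X] (RatFunc F) (l F d) =
    ∏ i ∈ Finset.range d, (RatFunc.X - RatFunc.X ^ Fintype.card F ^ (i + 1)) := by
  simp [l, RatFunc.algebraMap_X]

theorem algebraMap_l_ne_zero (d : ℕ) : algebraMap F[X] (RatFunc F) (l F d) ≠ 0 := by
  rw [algebraMap_l]
  refine Finset.prod_ne_zero_iff.2 fun i _ => ?_
  rw [← neg_sub]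
  exact neg_ne_zero.2 (ratFuncX_pow_card_sub_ne_zero F i)

theorem coeff_one_eq_zero_of_X_sq_dvd {R : Type*} [CommRing R] {p : R[X]} (h : X ^ 2 ∣ p) :
    p.coeff 1 = 0 :=
  X_pow_dvd_iff.1 h 1 one_lt_two

theorem coeff_one_carlitzE (j : ℕ) :
    (carlitzE F j).coeff 1 = (algebraMap F[X] (RatFunc F) (l F j))⁻¹ := by
  induction j with
  | zero => simp [carlitzE, l]
  | succ j ih =>
    have h : (carlitzE F j ^ Fintype.card F).coeff 1 = 0 :=
      coeff_one_eq_zero_of_X_sq_dvd ((pow_dvd_pow_of_dvd (X_dvd_carlitzE F j) 2).trans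
        (pow_dvd_pow _ Fintype.one_lt_card))
    rw [carlitzE, coeff_C_mul, coeff_sub, h, ih, l_succ, map_mul, mul_inv, zero_sub,
      map_sub, map_pow, RatFunc.algebraMap_X, ← neg_sub (RatFunc.X ^ _), inv_neg]
    ring

/-- The values `b_j(θ^{q^i})` are the coefficients of `z^{q^i}` in the basis of the `E_j`. -/
theorem sum_carlitzE_mul (z : RatFunc F) (i : ℕ) :
    ∑ j ∈ Finset.range (i + 1), (carlitzE F j).eval z * ∏ u ∈ Finset.range j,
      ((RatFunc.X : RatFunc F) ^ Fintype.card F ^ i - RatFunc.X ^ Fintype.card F ^ u) =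
    z ^ Fintype.card F ^ i := by
  induction i with
  | zero => simp [carlitzE]
  | succ i ih =>
    set q := Fintype.card F with hq
    set y : RatFunc F := RatFunc.X ^ q ^ (i + 1) with hy
    -- The Frobenius twists of the `b_j`, evaluated at `y`.
    let B : ℕ → RatFunc F := fun j => ∏ u ∈ Finset.range j, (y - RatFunc.X ^ q ^ (u + 1))
    have hB (j : ℕ) : ∏ u ∈ Finset.range (j + 1), (y - RatFunc.X ^ q ^ u) =
        (y - RatFunc.X) * B j := by
      rw [Finset.prod_range_succ', mul_comm]; simp [B]
    have hE (j : ℕ) : (carlitzE F j).eval z ^ q = (carlitzE F j).eval z +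
        (RatFunc.X ^ q ^ (j + 1) - RatFunc.X) * (carlitzE F (j + 1)).eval z := by
      simpa using congrArg (eval z) (carlitzE_pow_card F j)
    have tele (n : ℕ) : ∑ j ∈ Finset.range (n + 1), (carlitzE F j).eval z *
        ∏ u ∈ Finset.range j, (y - RatFunc.X ^ q ^ u) =
        (∑ j ∈ Finset.range n, (carlitzE F j).eval z ^ q * B j) + (carlitzE F n).eval z * B n := by
      induction n with
      | zero => simp [B]
      | succ n ihn =>
        rw [Finset.sum_range_succ, ihn, Finset.sum_range_succ _ n, hB, hE]
        have : B (n + 1) = B n * (y - RatFunc.X ^ q ^ (n + 1)) := Finset.prod_range_succ _ _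
        rw [this]
        ring
    have hB0 : B (i + 1) = 0 := Finset.prod_eq_zero (Finset.self_mem_range_succ i) (sub_self _)
    rw [tele, hB0, mul_zero, add_zero, pow_succ q i, pow_mul, ← ih, hq, card_pow_sum]
    refine Finset.sum_congr rfl fun j _ => ?_
    rw [mul_pow, ← Finset.prod_pow]
    congr 1
    refine Finset.prod_congr rfl fun u _ => ?_
    have := map_sub (FiniteField.frobeniusAlgHom F (RatFunc F))
      (RatFunc.X ^ q ^ i) (RatFunc.X ^ q ^ u)
    simp only [FiniteField.coe_frobeniusAlgHom] at this
    rw [this, hy, ← pow_mul, ← pow_mul, pow_succ, pow_succ]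

theorem aeval_pow_card_pow {R : Type*} [CommRing R] [Algebra F R] (a : F[X]) (x : R) (i : ℕ) :
    aeval (x ^ Fintype.card F ^ i) a = aeval x a ^ Fintype.card F ^ i := by
  induction i with
  | zero => simp
  | succ i ih =>
    rw [pow_succ, pow_mul, pow_mul, ← ih]
    exact aeval_algHom_apply (FiniteField.frobeniusAlgHom F R) _ a

variable {F}

theorem aeval_b {R : Type*} [CommRing R] [Algebra F[X] R] (x : R) (j : ℕ) :
    aeval x (b F j) = ∏ u ∈ Finset.range j, (x - algebraMap F[X] R X ^ Fintype.card F ^ u) := by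
  simp [b]

theorem monic_b (j : ℕ) : (b F j).Monic := monic_prod_of_monic _ _ fun _ _ => monic_X_sub_C _

theorem natDegree_b (j : ℕ) : (b F j).natDegree = j := by
  rw [b, natDegree_prod_of_monic _ _ fun _ _ => monic_X_sub_C _]
  simp only [natDegree_X_sub_C, Finset.sum_const, Finset.card_range, smul_eq_mul, mul_one]

/-- The expansion `a(t) = ∑_{j<N} E_j(a) b_j(t)` for `deg a < N`. -/
theorem map_eq_sum_carlitzE {a : F[X]} {N : ℕ} (ha : a.degree < N) :
    a.map (algebraMap F (RatFunc F)) = ∑ j ∈ Finset.range N,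
      C ((carlitzE F j).eval (algebraMap F[X] (RatFunc F) a)) *
        (b F j).map (algebraMap F[X] (RatFunc F)) := by
  refine eq_of_degrees_lt_of_eval_index_eq (s := Finset.range N)
    (v := fun i => RatFunc.X ^ Fintype.card F ^ i) ((ratFuncX_pow_card_injective F).injOn) ?_ ?_ ?_
  · simpa using ha
  · refine (degree_sum_le _ _).trans_lt ?_
    rw [Finset.sup_lt_iff (by simp [bot_lt_iff_ne_bot])]
    intro j hj
    refine (degree_mul_le _ _).trans_lt ?_
    rw [degree_map_eq_of_injective (RatFunc.algebraMap_injective F),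
      degree_eq_natDegree (monic_b j).ne_zero, natDegree_b, Finset.card_range]
    calc _ ≤ (0 : WithBot ℕ) + j := by gcongr; exact degree_C_le
      _ < N := by simpa using hj
  · intro i hi
    rw [eval_map_algebraMap, aeval_pow_card_pow, eval_finsetSum]
    have hX : aeval (RatFunc.X : RatFunc F) a = algebraMap F[X] (RatFunc F) a := by
      rw [← RatFunc.algebraMap_X]
      simp
    rw [hX, ← sum_carlitzE_mul]
    have hle : Finset.range (i + 1) ⊆ Finset.range N := by simpa using hi
    simp only [eval_mul, eval_C, eval_map_algebraMap, aeval_b, RatFunc.algebraMap_X]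
    refine Finset.sum_subset hle fun j _ hj => ?_
    rw [Finset.prod_eq_zero (i := i) (by simpa using hj) (sub_self _), mul_zero]

theorem carlitzE_eval_eq_zero {a : F[X]} {j : ℕ} (ha : a.degree < j) :
    (carlitzE F j).eval (algebraMap F[X] (RatFunc F) a) = 0 := by
  have h1 := map_eq_sum_carlitzE ha
  have h2 := map_eq_sum_carlitzE (ha.trans (show (j : WithBot ℕ) < (j + 1 : ℕ) by
    exact_mod_cast j.lt_succ_self))
  rw [Finset.sum_range_succ, ← h1, left_eq_add, mul_eq_zero] at h2
  rcases h2 with h | h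
  · exact C_eq_zero.1 h
  · exact absurd h ((monic_b j).map _).ne_zero

theorem aeval_eq_sum_carlitzE {R : Type*} [CommRing R] [Algebra (RatFunc F) R]
    [Algebra F[X] R] [IsScalarTower F[X] (RatFunc F) R] [Algebra F R]
    [IsScalarTower F (RatFunc F) R] {a : F[X]} {N : ℕ} (ha : a.degree < N) (x : R) :
    aeval x a = ∑ j ∈ Finset.range N, algebraMap (RatFunc F) R
      ((carlitzE F j).eval (algebraMap F[X] (RatFunc F) a)) * aeval x (b F j) := by
  have h := congrArg (aeval x) (map_eq_sum_carlitzE ha)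
  simpa only [aeval_map_algebraMap, map_sum, map_mul, aeval_C] using h

end

/-! ### Sums over the polynomials of degree `< d` -/

section

variable (F : Type*) [Field F] [Fintype F]

theorem finite_degreeLT (d : ℕ) : (degreeLT F d : Set F[X]).Finite :=
  have : Finite (degreeLT F d) := Finite.of_equiv _ (degreeLTEquiv F d).toEquiv.symm
  Set.toFinite _

/-- The polynomials of `A` of degree `< d`, an `F`-vector space of dimension `d`. -/
def polysLT (d : ℕ) : Finset F[X] := (finite_degreeLT F d).toFinset

open Classical in
/-- The monic polynomials of `A` of degree `< d`. -/
def monicsLT (d : ℕ) : Finset F[X] := {a ∈ polysLT F d | a.Monic}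

variable {F}

theorem mem_polysLT {d : ℕ} {a : F[X]} : a ∈ polysLT F d ↔ a.degree < d := by
  simp [polysLT, mem_degreeLT]

theorem mem_monicsLT {d : ℕ} {a : F[X]} : a ∈ monicsLT F d ↔ a.degree < d ∧ a.Monic := by
  simp [monicsLT, mem_polysLT]

theorem mem_monicOfDegree {d : ℕ} {a : F[X]} :
    a ∈ monicOfDegree F d ↔ a.Monic ∧ a.natDegree = d := by
  simp [monicOfDegree]

variable (F) in
theorem card_polysLT (d : ℕ) : (polysLT F d).card = Fintype.card F ^ d := by
  rw [polysLT, ← Set.ncard_eq_toFinset_card _ (finite_degreeLT F d), ← Nat.card_coe_set_eq]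
  have := Nat.card_congr (degreeLTEquiv F d).toEquiv
  simpa using this

theorem sum_range_monicOfDegree {R : Type*} [AddCommMonoid R] (d : ℕ) (f : F[X] → R) :
    ∑ i ∈ Finset.range d, ∑ a ∈ monicOfDegree F i, f a = ∑ a ∈ monicsLT F d, f a := by
  rw [← Finset.sum_fiberwise_of_maps_to (s := monicsLT F d) (t := Finset.range d) (g := natDegree)]
  · refine Finset.sum_congr rfl fun i hi => Finset.sum_congr ?_ fun _ _ => rfl
    ext a
    simp only [mem_monicOfDegree, Finset.mem_filter, mem_monicsLT]
    refine ⟨fun ⟨h1, h2⟩ => ⟨⟨?_, h1⟩, h2⟩, fun ⟨⟨_, h1⟩, h2⟩ => ⟨h1, h2⟩⟩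
    rw [degree_eq_natDegree h1.ne_zero, h2]
    exact_mod_cast Finset.mem_range.1 hi
  · intro a ha
    rw [mem_monicsLT] at ha
    rw [Finset.mem_range, ← Nat.cast_lt (α := WithBot ℕ), ← degree_eq_natDegree ha.2.ne_zero]
    exact ha.1

/-- A function on nonzero polynomials that is invariant under `Fˣ` has, over the nonzero
polynomials of degree `< d`, the sum `(q - 1) ∑ = - ∑` over the monic ones. -/
theorem sum_polysLT_erase_zero [DecidableEq F[X]] {R : Type*} [CommRing R] [Algebra F R] (d : ℕ)
    (f : F[X] → R) (hf : ∀ (c : F) (a : F[X]), c ≠ 0 → a ≠ 0 → f (C c * a) = f a) :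
    ∑ a ∈ (polysLT F d).erase 0, f a = -∑ a ∈ monicsLT F d, f a := by
  classical
  have h : ∑ a ∈ (polysLT F d).erase 0, f a =
      ∑ x ∈ (Finset.univ : Finset Fˣ) ×ˢ monicsLT F d, f (C (x.1 : F) * x.2) := by
    symm
    refine Finset.sum_bij' (fun x _ => C (x.1 : F) * x.2)
      (fun a _ => if h : a = 0 then (1, a) else
        (Units.mk0 a.leadingCoeff (leadingCoeff_ne_zero.2 h), C a.leadingCoeff⁻¹ * a))
      ?_ ?_ ?_ ?_ ?_
    · rintro ⟨c, a⟩ hx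
      simp only [Finset.mem_product, mem_monicsLT] at hx
      simp only [Finset.mem_erase, mem_polysLT, degree_C_mul c.ne_zero]
      exact ⟨mul_ne_zero (C_ne_zero.2 c.ne_zero) hx.2.2.ne_zero, hx.2.1⟩
    · intro a ha
      simp only [Finset.mem_erase, mem_polysLT] at ha
      have h0 : a.leadingCoeff⁻¹ ≠ 0 := inv_ne_zero (leadingCoeff_ne_zero.2 ha.1)
      rw [dif_neg ha.1]
      simp only [Finset.mem_product, Finset.mem_univ, true_and, mem_monicsLT, degree_C_mul h0]
      refine ⟨ha.2, ?_⟩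
      rw [mul_comm]
      exact monic_mul_leadingCoeff_inv ha.1
    · rintro ⟨c, a⟩ hx
      simp only [Finset.mem_product, mem_monicsLT] at hx
      have h0 : C (c : F) * a ≠ 0 := mul_ne_zero (C_ne_zero.2 c.ne_zero) hx.2.2.ne_zero
      rw [dif_neg h0]
      have hl : (C (c : F) * a).leadingCoeff = c := by
        rw [leadingCoeff_mul, leadingCoeff_C, hx.2.2.leadingCoeff, mul_one]
      ext : 1
      · ext; simp [hl]
      · simp only [hl]
        rw [← mul_assoc, ← C_mul, inv_mul_cancel₀ c.ne_zero, C_1, one_mul]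
    · intro a ha
      simp only [Finset.mem_erase] at ha
      rw [dif_neg ha.1]
      simp only [Units.val_mk0]
      rw [← mul_assoc, ← C_mul, mul_inv_cancel₀ (leadingCoeff_ne_zero.2 ha.1), C_1, one_mul]
    · intros; rfl
  rw [h, Finset.sum_product]
  have h2 (c : Fˣ) : ∑ a ∈ monicsLT F d, f (C (c : F) * a) = ∑ a ∈ monicsLT F d, f a :=
    Finset.sum_congr rfl fun a ha => hf c a c.ne_zero (mem_monicsLT.1 ha).2.ne_zero
  have hq : ((Fintype.card F : ℕ) : R) = 0 := by
    rw [← map_natCast (algebraMap F R), FiniteField.cast_card_eq_zero, map_zero]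
  rw [Finset.sum_congr rfl fun c _ => h2 c, Finset.sum_const, Finset.card_univ,
    Fintype.card_units, nsmul_eq_mul, Nat.cast_sub Fintype.card_pos, hq]
  simp

/-- A polynomial of degree less than `q^d - 1` has zero sum over the `q^d` polynomials of degree
`< d`: by Lagrange interpolation this sum is a multiple of its coefficient of degree `q^d - 1`,
since all nodal weights of an additive group coincide. -/
theorem sum_polysLT_eval {h : (RatFunc F)[X]} {d : ℕ}
    (hh : h.degree < (Fintype.card F ^ d - 1 : ℕ)) :
    ∑ a ∈ polysLT F d, h.eval (algebraMap F[X] (RatFunc F) a) = 0 := by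
  classical
  have hinj := (RatFunc.algebraMap_injective F)
  have hlag := Lagrange.coeff_eq_sum (s := polysLT F d) (v := algebraMap F[X] (RatFunc F))
    (P := h) hinj.injOn (by
      rw [card_polysLT]
      exact hh.trans_le (by exact_mod_cast Nat.sub_le _ _))
  rw [card_polysLT, coeff_eq_zero_of_degree_lt hh] at hlag
  have hw (a) (ha : a ∈ polysLT F d) : ∏ c ∈ (polysLT F d).erase a,
      (algebraMap F[X] (RatFunc F) a - algebraMap F[X] (RatFunc F) c) =
      ∏ c ∈ (polysLT F d).erase 0, algebraMap F[X] (RatFunc F) c := by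
    have hsub {x y : F[X]} (hx : x ∈ polysLT F d) (hy : y ∈ polysLT F d) :
        x - y ∈ polysLT F d := by
      simp only [polysLT, Set.Finite.mem_toFinset, SetLike.mem_coe] at *
      exact sub_mem hx hy
    refine Finset.prod_nbij' (fun c => a - c) (fun c => a - c) ?_ ?_ ?_ ?_ ?_
    · intro c hc
      rw [Finset.mem_erase] at hc ⊢
      exact ⟨sub_ne_zero.2 hc.1.symm, hsub ha hc.2⟩
    · intro c hc
      rw [Finset.mem_erase] at hc ⊢
      exact ⟨fun h => hc.1 (by simpa using h), hsub ha hc.2⟩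
    · intro c _; simp
    · intro c _; simp
    · intro c _; simp
  rw [Finset.sum_congr rfl fun a ha => by rw [hw a ha], ← Finset.sum_div] at hlag
  rcases div_eq_zero_iff.1 hlag.symm with h0 | h0
  · exact h0
  · rw [Finset.prod_eq_zero_iff] at h0
    obtain ⟨c, hc, hc0⟩ := h0
    exact absurd (hinj (hc0.trans (map_zero _).symm)) (Finset.ne_of_mem_erase hc)

/-- The functional `f ↦ -∑ f(a)/a`, over the nonzero `a` of degree `< d`, on polynomials without
constant term and of degree `< q^d` is the coefficient of `z`. The term of `a = 0` vanishes, being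
a division by zero. -/
theorem sum_polysLT_eval_div {g : (RatFunc F)[X]} {d : ℕ} (hX : X ∣ g)
    (hg : g.degree < (Fintype.card F ^ d : ℕ)) :
    ∑ a ∈ polysLT F d, g.eval (algebraMap F[X] (RatFunc F) a) / algebraMap F[X] (RatFunc F) a =
      -g.coeff 1 := by
  classical
  obtain ⟨h, rfl⟩ := hX
  have hmem : (0 : F[X]) ∈ polysLT F d := by simp [mem_polysLT, bot_lt_iff_ne_bot]
  have hdeg : h.degree < (Fintype.card F ^ d - 1 : ℕ) := by
    rcases eq_or_ne h 0 with rfl | h0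
    · simp [bot_lt_iff_ne_bot]
    · rw [degree_mul, degree_X, degree_eq_natDegree h0] at hg
      rw [degree_eq_natDegree h0]
      norm_cast at hg ⊢
      omega
  have := sum_polysLT_eval hdeg
  rw [← Finset.add_sum_erase _ _ hmem, map_zero, ← coeff_zero_eq_eval_zero] at this
  rw [← Finset.add_sum_erase _ _ hmem, map_zero, div_zero, zero_add, coeff_X_mul,
    ← eq_neg_iff_add_eq_zero.2 ((add_comm _ _).trans this)]
  refine Finset.sum_congr rfl fun a ha => ?_
  have : algebraMap F[X] (RatFunc F) a ≠ 0 := by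
    simpa using Finset.ne_of_mem_erase ha
  rw [eval_mul, eval_X, mul_div_cancel_left₀ _ this]

end

/-! ### Sums of products of Carlitz polynomials -/

section

variable (F : Type*) [Field F] [Fintype F]

/-- The sum `∑ E_{j_1}(a) ⋯ E_{j_r}(a) / a` over the monic `a` of degree `< d`, where
`M = {j_1, …, j_r}`. -/
def carlitzSum (d : ℕ) (M : Multiset ℕ) : RatFunc F :=
  ∑ a ∈ monicsLT F d, (M.map fun j => (carlitzE F j).eval (algebraMap F[X] (RatFunc F) a)).prod /
    algebraMap F[X] (RatFunc F) a

variable {F}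

theorem carlitzE_eval_C_mul (c : F) (z : RatFunc F) (j : ℕ) :
    (carlitzE F j).eval (RatFunc.C c * z) = RatFunc.C c * (carlitzE F j).eval z := by
  induction j with
  | zero => simp [carlitzE]
  | succ j ih =>
    have hc : RatFunc.C c ^ Fintype.card F = RatFunc.C c := by
      rw [← map_pow, FiniteField.pow_card]
    simp only [carlitzE, eval_mul, eval_C, eval_sub, eval_pow, ih, mul_pow, hc]
    ring

theorem pow_eq_self_of_modEq {c : F} (hc : c ≠ 0) {n : ℕ} (hn : 1 ≤ n)
    (h : n ≡ 1 [MOD Fintype.card F - 1]) : c ^ n = c := by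
  obtain ⟨k, hk⟩ := (Nat.modEq_iff_dvd' hn).1 h.symm
  obtain rfl : n = (Fintype.card F - 1) * k + 1 := by omega
  rw [pow_succ, pow_mul, FiniteField.pow_card_sub_one_eq_one c hc, one_pow, one_mul]

/-- Up to sign, `carlitzSum` is a sum over the whole space of polynomials of degree `< d`. -/
theorem carlitzSum_eq_neg_sum {d : ℕ} {M : Multiset ℕ} (h0 : 1 ≤ M.card)
    (hM : M.card ≡ 1 [MOD Fintype.card F - 1]) :
    carlitzSum F d M = -∑ a ∈ polysLT F d,
      ((M.map (carlitzE F)).prod).eval (algebraMap F[X] (RatFunc F) a) /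
        algebraMap F[X] (RatFunc F) a := by
  classical
  have hmem : (0 : F[X]) ∈ polysLT F d := by simp [mem_polysLT, bot_lt_iff_ne_bot]
  rw [← Finset.add_sum_erase _ _ hmem, map_zero, div_zero, zero_add, sum_polysLT_erase_zero,
    neg_neg, carlitzSum]
  · refine Finset.sum_congr rfl fun a _ => ?_
    rw [eval_multiset_prod, Multiset.map_map]
    rfl
  · intro c a hc ha
    have hc' : RatFunc.C c ≠ 0 := by simpa using hc
    have ha' : algebraMap F[X] (RatFunc F) a ≠ 0 := by simpa using ha
    rw [map_mul, RatFunc.algebraMap_C]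
    simp only [eval_multiset_prod, Multiset.map_map, Function.comp_def, carlitzE_eval_C_mul,
      Multiset.prod_map_mul, Multiset.map_const', Multiset.prod_replicate]
    rw [← map_pow, pow_eq_self_of_modEq hc h0 hM, mul_div_mul_left _ _ hc']

theorem carlitzSum_eq_zero_of_le {d : ℕ} {M : Multiset ℕ} {j : ℕ} (hj : j ∈ M) (hd : d ≤ j) :
    carlitzSum F d M = 0 := by
  refine Finset.sum_eq_zero fun a ha => ?_
  have : (carlitzE F j).eval (algebraMap F[X] (RatFunc F) a) = 0 :=
    carlitzE_eval_eq_zero ((mem_monicsLT.1 ha).1.trans_le (by exact_mod_cast hd))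
  rw [Multiset.prod_eq_zero (Multiset.mem_map.2 ⟨j, hj, this⟩), zero_div]

theorem carlitzSum_replicate_add (d k : ℕ) (M : Multiset ℕ) :
    carlitzSum F d (Multiset.replicate (Fintype.card F) k + M) = carlitzSum F d (k ::ₘ M) +
      (RatFunc.X ^ Fintype.card F ^ (k + 1) - RatFunc.X) * carlitzSum F d ((k + 1) ::ₘ M) := by
  simp only [carlitzSum]
  rw [Finset.mul_sum, ← Finset.sum_add_distrib]
  refine Finset.sum_congr rfl fun a _ => ?_
  have h := congrArg (eval (algebraMap F[X] (RatFunc F) a)) (carlitzE_pow_card F k)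
  simp only [eval_pow, eval_add, eval_mul, eval_C] at h
  simp only [Multiset.map_add, Multiset.prod_add, Multiset.map_replicate, Multiset.prod_replicate,
    Multiset.map_cons, Multiset.prod_cons, h]
  ring

theorem sum_pred_mul_pow {q : ℕ} (hq : 1 ≤ q) (d : ℕ) :
    ∑ j ∈ Finset.range d, (q - 1) * q ^ j + 1 = q ^ d := by
  obtain ⟨r, rfl⟩ := Nat.exists_eq_add_of_le' hq
  induction d with
  | zero => simp
  | succ d ih =>
    rw [Finset.sum_range_succ, add_right_comm, ih]
    simp only [Nat.add_sub_cancel]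
    ring

/-- The sum over a monomial in the `E_j` whose exponents are base `q` digits is the coefficient of
`z` in this monomial. -/
theorem carlitzSum_eq_coeff_one {d : ℕ} {M : Multiset ℕ} (h0 : 1 ≤ M.card)
    (hM : M.card ≡ 1 [MOD Fintype.card F - 1]) (hlt : ∀ j ∈ M, j < d)
    (hcount : ∀ j, M.count j < Fintype.card F) :
    carlitzSum F d M = (M.map (carlitzE F)).prod.coeff 1 := by
  classical
  rw [carlitzSum_eq_neg_sum h0 hM, sum_polysLT_eval_div, neg_neg]
  · obtain ⟨j, hj⟩ := Multiset.card_pos_iff_exists_mem.1 h0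
    exact (X_dvd_carlitzE F j).trans (Multiset.dvd_prod (Multiset.mem_map_of_mem _ hj))
  · refine degree_le_natDegree.trans_lt ?_
    rw [Nat.cast_lt]
    refine (natDegree_multiset_prod_le _).trans_lt ?_
    rw [Multiset.map_map]
    refine (Multiset.sum_map_le_sum_map _ (fun j => Fintype.card F ^ j)
      fun j _ => natDegree_carlitzE_le F j).trans_lt ?_
    rw [Finset.sum_multiset_map_count, ← sum_pred_mul_pow Fintype.card_pos d, Nat.lt_succ_iff]
    refine (Finset.sum_le_sum (g := fun j => (Fintype.card F - 1) * Fintype.card F ^ j)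
      fun j _ => ?_).trans (Finset.sum_le_sum_of_subset fun j hj => ?_)
    · rw [smul_eq_mul]
      exact Nat.mul_le_mul_right _ (Nat.le_sub_one_of_lt (hcount j))
    · exact Finset.mem_range.2 (hlt j (Multiset.mem_toFinset.1 hj))

theorem carlitzSum_singleton {d j : ℕ} (hj : j < d) :
    carlitzSum F d {j} = (algebraMap F[X] (RatFunc F) (l F j))⁻¹ := by
  rw [carlitzSum_eq_coeff_one (by simp) (by simp; rfl) (by simpa using hj), Multiset.map_singleton,
    Multiset.prod_singleton, coeff_one_carlitzE]
  intro k
  exact (Multiset.count_le_card _ _).trans_lt (by simpa using Fintype.one_lt_card)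

theorem carlitzSum_eq_zero_of_count_lt {d : ℕ} {M : Multiset ℕ} (h0 : 2 ≤ M.card)
    (hM : M.card ≡ 1 [MOD Fintype.card F - 1]) (hcount : ∀ j, M.count j < Fintype.card F) :
    carlitzSum F d M = 0 := by
  by_cases hlt : ∀ j ∈ M, j < d
  · rw [carlitzSum_eq_coeff_one (by omega) hM hlt hcount]
    apply coeff_one_eq_zero_of_X_sq_dvd
    refine (pow_dvd_pow X h0).trans ?_
    have := Multiset.prod_dvd_prod_of_dvd (S := M) (fun _ => X) (carlitzE F)
      fun j _ => X_dvd_carlitzE F j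
    simpa using this
  · push Not at hlt
    obtain ⟨j, hj, hd⟩ := hlt
    exact carlitzSum_eq_zero_of_le hj hd

theorem exists_eq_replicate_add {M : Multiset ℕ} {k n : ℕ} (h : n ≤ M.count k) :
    ∃ M', M = Multiset.replicate n k + M' :=
  Multiset.le_iff_exists_add.1 (Multiset.le_count_iff_replicate_le.1 h)

/-- Products of `1 + r (q - 1)` factors `E_j`, `r ≥ 1`, one of which has index `j < d - r`, have
zero sum. This is what makes `F_d(1;s)` divisible by `∏ b_{d-m}(t_i)`. -/
theorem carlitzSum_eq_zero_of_add_lt {d r j : ℕ} (hr : 1 ≤ r) {M : Multiset ℕ}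
    (hM : M.card = 1 + r * (Fintype.card F - 1)) (hj : j ∈ M) (hd : j + r < d) :
    carlitzSum F d M = 0 := by
  have hq : 1 < Fintype.card F := Fintype.one_lt_card
  induction r, hr using Nat.le_induction generalizing M j with
  | base =>
    by_cases hcount : ∀ j, M.count j < Fintype.card F
    · exact carlitzSum_eq_zero_of_count_lt (by omega) (by rw [hM]; simp [Nat.ModEq]) hcount
    push Not at hcount
    obtain ⟨k, hk⟩ := hcount
    obtain ⟨M', rfl⟩ := exists_eq_replicate_add hk
    -- Here the product is `E_k^q`, and the two terms of the reduction cancel.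
    obtain rfl : M' = 0 := by
      rw [← Multiset.card_eq_zero]
      simp only [Multiset.card_add, Multiset.card_replicate] at hM
      omega
    obtain rfl : j = k := Multiset.eq_of_mem_replicate (by simpa using hj)
    rw [carlitzSum_replicate_add, Multiset.cons_zero, Multiset.cons_zero,
      carlitzSum_singleton (by omega), carlitzSum_singleton (by omega), l_succ, map_mul, map_sub,
      map_pow, RatFunc.algebraMap_X, mul_inv, ← neg_sub (RatFunc.X ^ _), inv_neg]
    field_simp [ratFuncX_pow_card_sub_ne_zero F j, algebraMap_l_ne_zero F j]
    ring
  | succ r hr ih =>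
    have hmul : (r + 1) * (Fintype.card F - 1) =
      r * (Fintype.card F - 1) + (Fintype.card F - 1) := by ring
    by_cases hcount : ∀ j, M.count j < Fintype.card F
    · exact carlitzSum_eq_zero_of_count_lt (by omega) (by rw [hM]; simp [Nat.ModEq]) hcount
    push Not at hcount
    obtain ⟨k, hk⟩ := hcount
    obtain ⟨M', rfl⟩ := exists_eq_replicate_add hk
    simp only [Multiset.card_add, Multiset.card_replicate] at hM
    have hcard (i : ℕ) : (i ::ₘ M').card = 1 + r * (Fintype.card F - 1) := by
      rw [Multiset.card_cons]
      omega
    rw [carlitzSum_replicate_add]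
    rcases Multiset.mem_add.1 hj with hj | hj
    · obtain rfl := Multiset.eq_of_mem_replicate hj
      rw [ih (hcard j) (Multiset.mem_cons_self _ _) (by omega),
        ih (hcard (j + 1)) (Multiset.mem_cons_self _ _) (by omega), mul_zero, add_zero]
    · rw [ih (hcard k) (Multiset.mem_cons_of_mem hj) (by omega),
        ih (hcard (k + 1)) (Multiset.mem_cons_of_mem hj) (by omega), mul_zero, add_zero]

/-- The sum of a power of `E_{d-1}`, which takes its values in `F` on the `a` of degree `< d`. -/
theorem carlitzSum_replicate {d r : ℕ} (hd : 1 ≤ d) :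
    carlitzSum F d (Multiset.replicate (1 + r * (Fintype.card F - 1)) (d - 1)) =
      (algebraMap F[X] (RatFunc F) (l F (d - 1)))⁻¹ := by
  have hq : 1 < Fintype.card F := Fintype.one_lt_card
  induction r with
  | zero => simp [carlitzSum_singleton (F := F) (show d - 1 < d by omega)]
  | succ r ih =>
    have hmul : 1 + (r + 1) * (Fintype.card F - 1) =
      Fintype.card F + r * (Fintype.card F - 1) := by rw [add_mul]; omega
    rw [hmul, Multiset.replicate_add, carlitzSum_replicate_add, ← Multiset.replicate_succ,
      add_comm (r * _) 1, ih, carlitzSum_eq_zero_of_le (Multiset.mem_cons_self _ _) (by omega),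
      mul_zero, add_zero]

theorem algebraMap_l_mul_inv {n k : ℕ} (h : k ≤ n) :
    algebraMap F[X] (RatFunc F) (l F n) * (algebraMap F[X] (RatFunc F) (l F k))⁻¹ =
      ∏ i ∈ Finset.Ico k n, (RatFunc.X - RatFunc.X ^ Fintype.card F ^ (i + 1)) := by
  rw [mul_inv_eq_iff_eq_mul₀ (algebraMap_l_ne_zero F k), algebraMap_l, algebraMap_l, mul_comm,
    Finset.prod_range_mul_prod_Ico _ h]

variable (F) in
/-- For fixed indices `k`, the sums of the products of the `E_{e+k}` over the monic `a` of degree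
`< e + m` are interpolated by a polynomial in `Y = θ^{q^e}`. -/
theorem exists_interpolate_carlitzSum (m : ℕ) {M : Multiset ℕ} (h0 : 1 ≤ M.card)
    (hM : M.card ≡ 1 [MOD Fintype.card F - 1]) :
    ∃ W : F[X][X], ∀ e : ℕ, algebraMap F[X] (RatFunc F) (l F (e + m - 1)) *
      carlitzSum F (e + m) (M.map (e + ·)) = aeval (RatFunc.X ^ Fintype.card F ^ e) W := by
  have hq : 1 < Fintype.card F := Fintype.one_lt_card
  induction hn : M.card using Nat.strong_induction_on generalizing M with | _ n ih
  subst hn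
  by_cases hcount : ∀ j, M.count j < Fintype.card F
  · by_cases h2 : 2 ≤ M.card
    · refine ⟨0, fun e => ?_⟩
      rw [carlitzSum_eq_zero_of_count_lt (by simpa using h2) (by simpa using hM), mul_zero,
        map_zero]
      intro j
      by_cases hj : e ≤ j
      · obtain ⟨k, rfl⟩ := Nat.exists_eq_add_of_le hj
        rw [Multiset.count_map_eq_count' _ _ (add_right_injective e)]
        exact hcount k
      · rw [Multiset.count_eq_zero_of_notMem (by simp; omega)]
        omega
    · obtain ⟨k, rfl⟩ := Multiset.card_eq_one.1 (show M.card = 1 by omega)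
      by_cases hk : k < m
      · refine ⟨∏ i ∈ Finset.Ico k (m - 1), (C X - X ^ Fintype.card F ^ (i + 1)), fun e => ?_⟩
        rw [Multiset.map_singleton, carlitzSum_singleton (by omega),
          algebraMap_l_mul_inv (by omega), show e + m - 1 = m - 1 + e by omega, add_comm e k,
          ← Finset.prod_Ico_add' _ k (m - 1) e]
        simp only [map_prod, map_sub, map_pow, aeval_X, aeval_C, RatFunc.algebraMap_X]
        refine Finset.prod_congr rfl fun i _ => ?_
        rw [← pow_mul, ← pow_add]
        congr 3
        omega
      · refine ⟨0, fun e => ?_⟩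
        rw [Multiset.map_singleton, carlitzSum_eq_zero_of_le (Multiset.mem_singleton_self _)
          (by omega), mul_zero, map_zero]
  · push Not at hcount
    obtain ⟨k, hk⟩ := hcount
    obtain ⟨M', rfl⟩ := exists_eq_replicate_add hk
    have hmod (i : ℕ) : (i ::ₘ M').card ≡ 1 [MOD Fintype.card F - 1] := by
      refine Nat.ModEq.trans ?_ hM
      rw [Multiset.card_cons, Multiset.card_add, Multiset.card_replicate,
        show Fintype.card F + M'.card = M'.card + 1 + (Fintype.card F - 1) by omega]
      simp [Nat.ModEq]
    have hlt (i : ℕ) : (i ::ₘ M').card <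
        (Multiset.replicate (Fintype.card F) k + M').card := by
      rw [Multiset.card_cons, Multiset.card_add, Multiset.card_replicate]
      omega
    obtain ⟨W₁, h₁⟩ := ih _ (hlt k) (by simp) (hmod _) rfl
    obtain ⟨W₂, h₂⟩ := ih _ (hlt (k + 1)) (by simp) (hmod _) rfl
    refine ⟨W₁ + (X ^ Fintype.card F ^ (k + 1) - C X) * W₂, fun e => ?_⟩
    specialize h₁ e
    specialize h₂ e
    rw [Multiset.map_cons] at h₁ h₂
    simp only [Multiset.map_add, Multiset.map_replicate, carlitzSum_replicate_add, map_add,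
      map_mul, map_sub, map_pow, aeval_X, aeval_C, RatFunc.algebraMap_X, ← h₁, ← h₂, ← pow_mul,
      ← pow_add]
    rw [add_assoc e k 1]
    ring

end

/-! ### The interpolating polynomial -/

section

variable {F : Type*} [Field F]

theorem algebraMap_X_eq_C (s : ℕ) :
    algebraMap F[X] (KT F s) X = MvPolynomial.C RatFunc.X := by
  rw [IsScalarTower.algebraMap_apply F[X] (RatFunc F) (KT F s), RatFunc.algebraMap_X]
  rfl

theorem substY_X_none {s : ℕ} (c : RatFunc F) :
    substY c (MvPolynomial.X none : KYT F s) = MvPolynomial.C c := by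
  simp [substY]

theorem substY_X_some {s : ℕ} (c : RatFunc F) (i : Fin s) :
    substY c (MvPolynomial.X (some i) : KYT F s) = MvPolynomial.X i := by
  simp [substY]

theorem degreeOf_substY_le {s : ℕ} (c : RatFunc F) (Q : KYT F s) (i : Fin s) :
    MvPolynomial.degreeOf i (substY c Q) ≤ MvPolynomial.degreeOf (some i) Q := by
  rw [substY, MvPolynomial.aeval_def, MvPolynomial.eval₂_eq']
  refine (MvPolynomial.degreeOf_sum_le _ _ _).trans (Finset.sup_le fun n hn => ?_)
  rw [MvPolynomial.algebraMap_eq]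
  refine (MvPolynomial.degreeOf_C_mul_le _ _ _).trans ?_
  refine (MvPolynomial.degreeOf_prod_le _ _ _).trans ?_
  rw [Finset.sum_eq_single (some i)]
  · refine le_trans ?_ (MvPolynomial.monomial_le_degreeOf (some i) hn)
    exact (MvPolynomial.degreeOf_X_self_pow i _).le
  · rintro (_ | j) _ hj
    · rw [Option.elim_none, ← map_pow, MvPolynomial.degreeOf_C]
    · exact MvPolynomial.degreeOf_X_pow_of_ne _ (by rintro rfl; exact hj rfl)
  · simp

theorem substY_aeval_X_none {s : ℕ} (c : RatFunc F) (W : F[X][X]) :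
    substY c (MvPolynomial.map (algebraMap F[X] (RatFunc F))
      (aeval (MvPolynomial.X none : AYT F s) W)) = MvPolynomial.C (aeval c W) := by
  induction W using Polynomial.induction_on' with
  | add p q hp hq => simp only [map_add, hp, hq]
  | monomial n a =>
    simp only [aeval_monomial, map_mul, map_pow, MvPolynomial.map_X, substY_X_none,
      MvPolynomial.algebraMap_eq, MvPolynomial.map_C]
    congr 1
    simp [substY]

variable [Fintype F]

theorem coeff_prod_aeval_X {ι R S : Type*} [Fintype ι] [CommRing R] [CommRing S] [Algebra S R]
    (p : ι → S[X]) (n : ι →₀ ℕ) :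
    MvPolynomial.coeff n (∏ i, aeval (MvPolynomial.X i : MvPolynomial ι R) (p i)) =
      ∏ i, algebraMap S R ((p i).coeff (n i)) := by
  classical
  set N := ∑ i, (p i).natDegree + ∑ i, n i + 1 with hN
  have h1 (i : ι) : (p i).natDegree < N := by
    have := Finset.single_le_sum (f := fun i => (p i).natDegree) (fun _ _ => Nat.zero_le _)
      (Finset.mem_univ i)
    omega
  have h2 (i : ι) : n i < N := by
    have := Finset.single_le_sum (f := fun i => n i) (fun _ _ => Nat.zero_le _) (Finset.mem_univ i)
    omega
  have hterm (k : ι → ℕ) : ∏ i, (p i).coeff (k i) • (MvPolynomial.X i : MvPolynomial ι R) ^ k i =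
      MvPolynomial.monomial (Finsupp.equivFunOnFinite.symm k)
        (∏ i, algebraMap S R ((p i).coeff (k i))) := by
    rw [MvPolynomial.monomial_eq, Finsupp.prod_fintype _ _ (by simp)]
    simp only [Algebra.smul_def, Finset.prod_mul_distrib, map_prod]
    rfl
  rw [Finset.prod_congr rfl fun i _ => aeval_eq_sum_range' (h1 i) _, Finset.prod_univ_sum,
    MvPolynomial.coeff_sum, Finset.sum_eq_single (n : ι → ℕ)]
  · rw [hterm, MvPolynomial.coeff_monomial, if_pos (by ext; simp)]
  · intro k _ hk
    rw [hterm, MvPolynomial.coeff_monomial, if_neg]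
    rintro rfl
    exact hk (by ext; simp)
  · intro h
    exact absurd (Fintype.mem_piFinset.2 fun i => Finset.mem_range.2 (h2 i)) h

theorem harmonicSum_one_eq (d s : ℕ) : harmonicSum F d 1 s = ∑ a ∈ monicsLT F d,
    MvPolynomial.C ((algebraMap F[X] (RatFunc F) a)⁻¹) *
      ∏ i : Fin s, aeval (MvPolynomial.X i : KT F s) a := by
  simp only [harmonicSum, powerSum, zpow_one]
  exact sum_range_monicOfDegree d _

/-- The expansion of `F_d(1;s)` in the products of the polynomials `b_{k_i}(t_i)`. -/
theorem harmonicSum_eq_sum_carlitzSum (d s : ℕ) : harmonicSum F d 1 s =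
    ∑ k ∈ Fintype.piFinset fun _ : Fin s => Finset.range d,
      MvPolynomial.C (carlitzSum F d (Finset.univ.val.map k)) *
        ∏ i, aeval (MvPolynomial.X i : KT F s) (b F (k i)) := by
  rw [harmonicSum_one_eq]
  simp only [carlitzSum, map_sum, Finset.sum_mul]
  rw [Finset.sum_comm]
  refine Finset.sum_congr rfl fun a ha => ?_
  rw [Finset.prod_congr rfl fun i _ => aeval_eq_sum_carlitzE (mem_monicsLT.1 ha).1
    (MvPolynomial.X i : KT F s), Finset.prod_univ_sum, Finset.mul_sum]
  refine Finset.sum_congr rfl fun k _ => ?_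
  rw [Finset.prod_mul_distrib, ← mul_assoc, Multiset.map_map, div_eq_inv_mul, map_mul]
  congr 2
  rw [MvPolynomial.algebraMap_eq, ← map_prod]
  rfl

/-- The coefficient of `∏ t_i^{d-1}` in `F_d(1;s)` comes from the product `E_{d-1}^s` alone, as the
`b_j` are monic of degree `j`. -/
theorem coeff_harmonicSum {d s r : ℕ} (hd : 1 ≤ d) (hs : s = 1 + r * (Fintype.card F - 1)) :
    MvPolynomial.coeff (Finsupp.equivFunOnFinite.symm fun _ => d - 1) (harmonicSum F d 1 s) =
      (algebraMap F[X] (RatFunc F) (l F (d - 1)))⁻¹ := by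
  rw [harmonicSum_eq_sum_carlitzSum, MvPolynomial.coeff_sum,
    Finset.sum_eq_single fun _ => d - 1]
  · have h : (b F (d - 1)).coeff (d - 1) = 1 := by
      simpa [natDegree_b] using (monic_b (F := F) (d - 1)).coeff_natDegree
    rw [MvPolynomial.coeff_C_mul, coeff_prod_aeval_X]
    simp [h, hs, carlitzSum_replicate hd]
  · intro k hk hne
    obtain ⟨i, hi⟩ := Function.ne_iff.1 hne
    have hlt := Finset.mem_range.1 (Fintype.mem_piFinset.1 hk i)
    rw [MvPolynomial.coeff_C_mul, coeff_prod_aeval_X, Finset.prod_eq_zero (Finset.mem_univ i),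
      mul_zero]
    rw [coeff_eq_zero_of_natDegree_lt, map_zero]
    rw [natDegree_b]
    simp only [Finsupp.equivFunOnFinite_symm_apply_apply]
    omega
  · intro h
    exact absurd (Fintype.mem_piFinset.2 fun i => Finset.mem_range.2 (by omega)) h

/-- Only the indices `k_i ≥ e = d - m` contribute to the expansion of `F_d(1;s)`. -/
theorem harmonicSum_eq_sum_shift {s m : ℕ} (hm : 1 ≤ m) (hs : s = 1 + m * (Fintype.card F - 1))
    (e : ℕ) : harmonicSum F (e + m) 1 s =
    ∑ k ∈ Fintype.piFinset fun _ : Fin s => Finset.range m,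
      MvPolynomial.C (carlitzSum F (e + m) ((Finset.univ.val.map k).map (e + ·))) *
        ∏ i, aeval (MvPolynomial.X i : KT F s) (b F (e + k i)) := by
  rw [harmonicSum_eq_sum_carlitzSum]
  symm
  refine Finset.sum_of_injOn (fun k i => e + k i) ?_ ?_ ?_ ?_
  · intro k _ k' _ h
    ext i
    simpa using congrFun h i
  · intro k hk
    simp only [Finset.mem_coe, Fintype.mem_piFinset, Finset.mem_range] at hk ⊢
    exact fun i => by have := hk i; omega
  · intro k hk hk'
    obtain ⟨i, hi⟩ : ∃ i, k i < e := by
      by_contra! h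
      refine hk' ⟨fun i => k i - e, ?_, funext fun i => Nat.add_sub_cancel' (h i)⟩
      simp only [Finset.mem_coe, Fintype.mem_piFinset, Finset.mem_range] at hk ⊢
      exact fun i => by have := hk i; have := h i; omega
    rw [carlitzSum_eq_zero_of_add_lt hm (by simpa using hs)
      (Multiset.mem_map_of_mem k (Finset.mem_univ i)) (by omega), map_zero, zero_mul]
  · intro k _
    rw [Multiset.map_map]
    rfl

theorem aeval_b_add {R : Type*} [CommRing R] [Algebra F[X] R] (x : R) (e k : ℕ) :
    aeval x (b F (e + k)) = aeval x (b F e) * ∏ u ∈ Finset.range k,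
      (x - (algebraMap F[X] R X ^ Fintype.card F ^ e) ^ Fintype.card F ^ u) := by
  rw [aeval_b, aeval_b, Finset.prod_range_add]
  simp only [← pow_mul, ← pow_add]

variable (F) in
/-- The polynomial `∑_k W_k(Y) ∏_i ∏_{u < k_i} (t_i - Y^{q^u})`, over the `k` with `k_i < m`, where
the `W_k` interpolate the sums of products of Carlitz polynomials. -/
theorem exists_interpolant {s m : ℕ} (hm : 1 ≤ m) (hs : s = 1 + m * (Fintype.card F - 1)) :
    ∃ P : AYT F s, (∀ i, MvPolynomial.degreeOf (some i) P ≤ m - 1) ∧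
      ∀ e, harmonicSum F (e + m) 1 s =
        MvPolynomial.C ((algebraMap F[X] (RatFunc F) (l F (e + m - 1)))⁻¹) *
          (∏ i : Fin s, aeval (MvPolynomial.X i : KT F s) (b F e)) *
          substY (RatFunc.X ^ Fintype.card F ^ e)
            (MvPolynomial.map (algebraMap F[X] (RatFunc F)) P) := by
  have hcard (k : Fin s → ℕ) : (Finset.univ.val.map k).card = s := by simp
  choose W hW using fun k : Fin s → ℕ => exists_interpolate_carlitzSum F m
    (M := Finset.univ.val.map k) (by rw [hcard, hs]; omega) (by rw [hcard, hs]; simp [Nat.ModEq])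
  refine ⟨∑ k ∈ Fintype.piFinset fun _ : Fin s => Finset.range m,
    aeval (MvPolynomial.X none) (W k) * ∏ i, ∏ u ∈ Finset.range (k i),
      (MvPolynomial.X (some i) - MvPolynomial.X none ^ Fintype.card F ^ u), fun i => ?_,
    fun e => ?_⟩
  · have hX (n : ℕ) : MvPolynomial.degreeOf (some i)
        ((MvPolynomial.X none : AYT F s) ^ n) = 0 :=
      MvPolynomial.degreeOf_X_pow_of_ne n (by simp)
    refine (MvPolynomial.degreeOf_sum_le _ _ _).trans (Finset.sup_le fun k hk => ?_)
    have hki := Finset.mem_range.1 (Fintype.mem_piFinset.1 hk i)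
    refine (MvPolynomial.degreeOf_mul_le _ _ _).trans ?_
    have hWk : MvPolynomial.degreeOf (some i)
        (aeval (MvPolynomial.X none : AYT F s) (W k)) = 0 := by
      rw [aeval_eq_sum_range]
      refine Nat.le_zero.1 ((MvPolynomial.degreeOf_sum_le _ _ _).trans
        (Finset.sup_le fun n _ => ?_))
      rw [MvPolynomial.smul_eq_C_mul]
      exact (MvPolynomial.degreeOf_C_mul_le _ _ _).trans (hX n).le
    rw [hWk, zero_add]
    refine (MvPolynomial.degreeOf_prod_le _ _ _).trans ?_
    rw [Finset.sum_eq_single i]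
    · refine (MvPolynomial.degreeOf_prod_le _ _ _).trans ?_
      refine (Finset.sum_le_card_nsmul _ _ 1 fun u _ => ?_).trans ?_
      · refine (MvPolynomial.degreeOf_sub_le _ _ _).trans ?_
        rw [hX, MvPolynomial.degreeOf_X_self]
        simp
      · simp; omega
    · intro j _ hj
      refine Nat.le_zero.1 ((MvPolynomial.degreeOf_prod_le _ _ _).trans ?_)
      refine (Finset.sum_le_card_nsmul _ _ 0 fun u _ => ?_).trans (by simp)
      refine (MvPolynomial.degreeOf_sub_le _ _ _).trans ?_
      rw [hX, MvPolynomial.degreeOf_X_of_ne (by simpa using hj.symm)]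
      simp
    · simp
  · rw [harmonicSum_eq_sum_shift hm hs, map_sum, map_sum, Finset.mul_sum]
    refine Finset.sum_congr rfl fun k _ => ?_
    have h := (eq_inv_mul_iff_mul_eq₀ (algebraMap_l_ne_zero F _)).2 (hW k e)
    rw [h, map_mul, map_mul, map_mul, substY_aeval_X_none,
      Finset.prod_congr rfl fun i _ => aeval_b_add _ _ _, Finset.prod_mul_distrib]
    simp only [map_prod, map_sub, map_pow, MvPolynomial.map_X, substY_X_none, substY_X_some]
    rw [algebraMap_X_eq_C]
    ring

end

/-! ### Sizes at the infinite place, the degree in `Y`, and uniqueness -/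

section

open WithZero

theorem prod_exp {ι : Type*} (s : Finset ι) (f : ι → ℤ) :
    ∏ i ∈ s, exp (f i) = exp (∑ i ∈ s, f i) := by
  classical
  induction s using Finset.induction_on with
  | empty => simp
  | insert a s ha ih => rw [Finset.prod_insert ha, Finset.sum_insert ha, exp_add, ih]

section Valuation

variable {F : Type*} [Field F] [DecidableEq (RatFunc F)]

theorem inftyValuation_eq_exp {x : RatFunc F} (hx : x ≠ 0) :
    RatFunc.inftyValuation F x = exp x.intDegree := by
  rw [RatFunc.inftyValuation_apply, RatFunc.inftyValuation_of_nonzero F hx]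

theorem inftyValuation_C_le_one (c : F) : RatFunc.inftyValuation F (RatFunc.C c) ≤ 1 := by
  rcases eq_or_ne c 0 with rfl | hc
  · simp
  · rw [RatFunc.inftyValuation.C F hc]

theorem inftyValuation_X_pow (n : ℕ) :
    RatFunc.inftyValuation F (RatFunc.X ^ n) = exp (n : ℤ) := by
  rw [map_pow, RatFunc.inftyValuation.X, ← exp_nsmul]
  simp

/-- At `θ^n` with `n` large, a polynomial has the size of its leading term. -/
theorem eventually_inftyValuation_eval {h : (RatFunc F)[X]} (hh : h ≠ 0) :
    ∀ᶠ n : ℕ in Filter.atTop, RatFunc.inftyValuation F (h.eval (RatFunc.X ^ n)) =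
      exp (h.leadingCoeff.intDegree + n * h.natDegree) := by
  have hlc : h.leadingCoeff ≠ 0 := leadingCoeff_ne_zero.2 hh
  have hlead (n : ℕ) : RatFunc.inftyValuation F (h.leadingCoeff * (RatFunc.X ^ n) ^ h.natDegree) =
      exp (h.leadingCoeff.intDegree + n * h.natDegree) := by
    rw [map_mul, ← pow_mul, inftyValuation_X_pow, inftyValuation_eq_exp hlc, ← exp_add]
    push_cast
    rfl
  have hev : ∀ᶠ n : ℕ in Filter.atTop, ∀ i ∈ Finset.range h.natDegree,
      RatFunc.inftyValuation F (h.coeff i * (RatFunc.X ^ n) ^ i) <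
        exp (h.leadingCoeff.intDegree + n * h.natDegree) := by
    rw [Filter.eventually_all_finset]
    intro i hi
    filter_upwards [Filter.eventually_gt_atTop
      ((h.coeff i).intDegree - h.leadingCoeff.intDegree).toNat] with n hn
    rcases eq_or_ne (h.coeff i) 0 with h0 | h0
    · simp [h0]
    rw [map_mul, ← pow_mul, inftyValuation_X_pow, inftyValuation_eq_exp h0, ← exp_add,
      exp_lt_exp]
    have hi' : i + 1 ≤ h.natDegree := Finset.mem_range.1 hi
    have hmul : (n : ℤ) * (i + 1) ≤ n * h.natDegree := by
      exact_mod_cast Nat.mul_le_mul_left n hi'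
    push_cast
    rw [mul_add, mul_one] at hmul
    omega
  filter_upwards [hev] with n hn
  rw [eval_eq_sum_range, Finset.sum_range_succ, coeff_natDegree, ← hlead]
  refine Valuation.map_add_eq_of_lt_right (RatFunc.inftyValuation F) ?_
  rw [hlead]
  exact Valuation.map_sum_lt (RatFunc.inftyValuation F) exp_ne_zero hn

theorem inftyValuation_aeval_le_one {x : RatFunc F} (hx : RatFunc.inftyValuation F x ≤ 1)
    (a : F[X]) :
    RatFunc.inftyValuation F (aeval x a) ≤ 1 := by
  rw [aeval_eq_sum_range]
  refine Valuation.map_sum_le _ fun i _ => ?_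
  rw [Algebra.smul_def, map_mul, map_pow]
  exact mul_le_one' (inftyValuation_C_le_one (a.coeff i)) (pow_le_one' hx i)

variable [Fintype F]

theorem inftyValuation_aeval_b {x : RatFunc F} (hx : RatFunc.inftyValuation F x ≤ 1) (e : ℕ) :
    RatFunc.inftyValuation F (aeval x (b F e)) =
      exp (∑ u ∈ Finset.range e, (Fintype.card F : ℤ) ^ u) := by
  rw [aeval_b, map_prod, ← prod_exp]
  refine Finset.prod_congr rfl fun u _ => ?_
  have hv := inftyValuation_X_pow (F := F) (Fintype.card F ^ u)
  rw [RatFunc.algebraMap_X, Valuation.map_sub_eq_of_lt_right, hv]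
  · simp
  · rw [hv]
    refine hx.trans_lt ?_
    rw [← exp_zero, exp_lt_exp]
    exact_mod_cast Nat.pos_of_ne_zero (pow_ne_zero _ Fintype.card_ne_zero)

theorem inftyValuation_l (d : ℕ) : RatFunc.inftyValuation F (algebraMap F[X] (RatFunc F) (l F d)) =
    exp (∑ i ∈ Finset.range d, (Fintype.card F : ℤ) ^ (i + 1)) := by
  rw [algebraMap_l, map_prod, ← prod_exp]
  refine Finset.prod_congr rfl fun u _ => ?_
  have hv := inftyValuation_X_pow (F := F) (Fintype.card F ^ (u + 1))
  rw [Valuation.map_sub_eq_of_lt_right, hv]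
  · simp
  · rw [hv, RatFunc.inftyValuation.X, exp_lt_exp]
    exact_mod_cast Nat.one_lt_pow (Nat.succ_ne_zero u) Fintype.one_lt_card

/-- When the `t_i` are specialised to elements of size at most `1`, the term of `a = 1` dominates
the sum `F_d(1;s)`. -/
theorem inftyValuation_eval_harmonicSum {d s : ℕ} (hd : 1 ≤ d) {x : Fin s → RatFunc F}
    (hx : ∀ i, RatFunc.inftyValuation F (x i) ≤ 1) :
    RatFunc.inftyValuation F (MvPolynomial.eval x (harmonicSum F d 1 s)) = 1 := by
  classical
  have h1 : (1 : F[X]) ∈ monicsLT F d := by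
    rw [mem_monicsLT, degree_one]
    exact ⟨by exact_mod_cast hd, monic_one⟩
  have hterm (a : F[X]) : MvPolynomial.eval x (MvPolynomial.C ((algebraMap F[X] (RatFunc F) a)⁻¹) *
      ∏ i : Fin s, aeval (MvPolynomial.X i : KT F s) a) =
      (algebraMap F[X] (RatFunc F) a)⁻¹ * ∏ i, aeval (x i) a := by
    rw [map_mul, MvPolynomial.eval_C, map_prod]
    congr 1
    refine Finset.prod_congr rfl fun i _ => ?_
    have := aeval_algHom_apply
      ((MvPolynomial.aeval x : KT F s →ₐ[RatFunc F] RatFunc F).restrictScalars F)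
      (MvPolynomial.X i) a
    simpa [MvPolynomial.aeval_eq_eval] using this.symm
  rw [harmonicSum_one_eq, map_sum, Finset.sum_congr rfl fun a _ => hterm a,
    ← Finset.add_sum_erase _ _ h1]
  have hone : (algebraMap F[X] (RatFunc F) 1)⁻¹ * ∏ i, aeval (x i) (1 : F[X]) = 1 := by simp
  rw [hone, Valuation.map_add_eq_of_lt_left, map_one]
  rw [map_one]
  refine Valuation.map_sum_lt _ one_ne_zero fun a ha => ?_
  obtain ⟨ha1, ha⟩ := Finset.mem_erase.1 ha
  have hmon := (mem_monicsLT.1 ha).2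
  rw [map_mul, map_prod, map_inv₀, RatFunc.inftyValuation_apply,
    RatFunc.inftyValuation.polynomial F hmon.ne_zero]
  refine (mul_le_of_le_one_right' (Finset.prod_le_one' fun i _ =>
    inftyValuation_aeval_le_one (hx i) a)).trans_lt ?_
  rw [← exp_neg, ← exp_zero, exp_lt_exp, neg_lt_zero]
  exact_mod_cast Nat.pos_of_ne_zero fun h => ha1 (hmon.natDegree_eq_zero.1 h)

end Valuation

variable {F : Type*} [Field F]

theorem eval_substY {s : ℕ} (c : RatFunc F) (x : Fin s → RatFunc F) (Q : KYT F s) :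
    MvPolynomial.eval x (substY c Q) = MvPolynomial.eval (fun o => o.elim c x) Q := by
  have h : (MvPolynomial.aeval x).comp (substY c) =
      (MvPolynomial.aeval fun o : Option (Fin s) => o.elim c x : KYT F s →ₐ[RatFunc F] _) := by
    refine MvPolynomial.algHom_ext ?_
    rintro (_ | i) <;> simp [substY]
  exact DFunLike.congr_fun h Q

theorem eq_of_substY_eq {s : ℕ} {Q Q' : KYT F s} {S : Set (RatFunc F)} (hS : S.Infinite)
    (h : ∀ c ∈ S, substY c Q = substY c Q') : Q = Q' := by
  have : Infinite (RatFunc F) := hS.to_subtype.of_injective _ Subtype.val_injective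
  refine MvPolynomial.funext_set (fun o => o.elim S fun _ => Set.univ) ?_ fun x hx => ?_
  · rintro (_ | i)
    · exact hS
    · exact Set.infinite_univ
  · have hx0 : x none ∈ S := hx none trivial
    have hx' : x = fun o => o.elim (x none) fun i => x (some i) := by
      ext (_ | i) <;> rfl
    rw [hx', ← eval_substY, ← eval_substY, h _ hx0]

theorem map_algebraMap_injective {s : ℕ} : Function.Injective
    (MvPolynomial.map (algebraMap F[X] (RatFunc F)) : AYT F s → KYT F s) :=
  MvPolynomial.map_injective _ (RatFunc.algebraMap_injective F)

variable [Fintype F]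

/-- The degree in `Y` of the interpolating polynomial, found by comparing the sizes at the infinite
place of both sides of the interpolation formula, after a specialisation `t_i = θ^{-n_i}` with
`n_i ≥ 1` at which the leading coefficient in `Y` does not vanish. -/
theorem degreeOf_none_interpolant {s m : ℕ} (hm : 1 ≤ m) (hs : s = 1 + m * (Fintype.card F - 1))
    {P : AYT F s} (hP : P ≠ 0) (h : ∀ e, harmonicSum F (e + m) 1 s =
      MvPolynomial.C ((algebraMap F[X] (RatFunc F) (l F (e + m - 1)))⁻¹) *
        (∏ i : Fin s, aeval (MvPolynomial.X i : KT F s) (b F e)) *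
        substY (RatFunc.X ^ Fintype.card F ^ e)
          (MvPolynomial.map (algebraMap F[X] (RatFunc F)) P)) :
    MvPolynomial.degreeOf none P =
      (Fintype.card F ^ m - 1) / (Fintype.card F - 1) - m := by
  classical
  have hq : 1 < Fintype.card F := Fintype.one_lt_card
  set q := Fintype.card F with hqdef
  set Q : KYT F s := MvPolynomial.map (algebraMap F[X] (RatFunc F)) P with hQ
  have hQ0 : Q ≠ 0 := fun h0 => hP (map_algebraMap_injective (h0.trans (map_zero _).symm))
  set f := MvPolynomial.optionEquivLeft (RatFunc F) (Fin s) Q with hf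
  have hf0 : f ≠ 0 := by simpa [hf] using hQ0
  have hinj : Function.Injective fun n : ℕ => ((RatFunc.X : RatFunc F) ^ (n + 1))⁻¹ :=
    fun i j hij => Nat.succ_injective (ratFuncX_pow_injective F (inv_injective hij))
  -- The specialisation of the `t_i`.
  obtain ⟨x, hx, hxf⟩ : ∃ x : Fin s → RatFunc F, (∀ i, RatFunc.inftyValuation F (x i) ≤ 1) ∧
      MvPolynomial.eval x f.leadingCoeff ≠ 0 := by
    by_contra! hcon
    refine leadingCoeff_ne_zero.2 hf0 (MvPolynomial.funext_set
      (fun _ => Set.range fun n : ℕ => ((RatFunc.X : RatFunc F) ^ (n + 1))⁻¹)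
      (fun _ => Set.infinite_range_of_injective hinj) fun x hx => ?_)
    rw [map_zero]
    refine hcon x fun i => ?_
    obtain ⟨n, hn⟩ := hx i trivial
    rw [← hn]
    simp only
    rw [map_inv₀, inftyValuation_X_pow, ← exp_neg, ← exp_zero, exp_le_exp]
    omega
  set g := f.map (MvPolynomial.eval x) with hg
  have hgdeg : g.natDegree = MvPolynomial.degreeOf none P := by
    rw [hg, natDegree_map_of_leadingCoeff_ne_zero _ hxf, hf,
      MvPolynomial.natDegree_optionEquivLeft, hQ, MvPolynomial.degreeOf_def,
      MvPolynomial.degrees_map_of_injective _ (RatFunc.algebraMap_injective F),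
      ← MvPolynomial.degreeOf_def]
  have hg0 : g ≠ 0 := fun h0 => hxf (by
    rw [← leadingCoeff_map_of_leadingCoeff_ne_zero _ hxf, ← hg, h0, leadingCoeff_zero])
  set D := MvPolynomial.degreeOf none P with hD
  -- The degrees in `θ` of both sides, for large `e`.
  have key : ∀ᶠ e : ℕ in Filter.atTop, ∑ i ∈ Finset.range (e + m - 1), (q : ℤ) ^ (i + 1) =
      s * ∑ u ∈ Finset.range e, (q : ℤ) ^ u + (g.leadingCoeff.intDegree + q ^ e * D) := by
    have hev := (tendsto_pow_atTop_atTop_of_one_lt hq).eventually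
      (eventually_inftyValuation_eval hg0)
    filter_upwards [hev] with e he
    have hval := inftyValuation_eval_harmonicSum (d := e + m) (by omega) hx
    have hb (i : Fin s) : MvPolynomial.eval x (aeval (MvPolynomial.X i : KT F s) (b F e)) =
        aeval (x i) (b F e) := by
      have := aeval_algHom_apply
        ((MvPolynomial.aeval x : KT F s →ₐ[RatFunc F] RatFunc F).restrictScalars F[X])
        (MvPolynomial.X i) (b F e)
      simpa [MvPolynomial.aeval_eq_eval] using this.symm
    have hgQ : MvPolynomial.eval x (substY (RatFunc.X ^ q ^ e) Q) =
        g.eval (RatFunc.X ^ q ^ e) := by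
      rw [eval_substY, MvPolynomial.optionEquivLeft_elim_eval]
    rw [h, map_mul, map_mul, map_mul, map_mul, map_prod, map_prod, MvPolynomial.eval_C, map_inv₀,
      inftyValuation_l, hgQ, he, hgdeg] at hval
    simp only [hb, inftyValuation_aeval_b (hx _), Finset.prod_const, Finset.card_univ,
      Fintype.card_fin] at hval
    rw [← exp_neg, ← exp_nsmul, ← exp_add, ← exp_add, ← exp_zero, exp_inj] at hval
    simp only [nsmul_eq_mul] at hval
    push_cast at hval
    linarith
  obtain ⟨e, he⟩ := Filter.eventually_atTop.1 key
  have h1 := he e le_rfl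
  have h2 := he (e + 1) (Nat.le_succ e)
  rw [show e + 1 + m - 1 = e + m - 1 + 1 by omega, Finset.sum_range_succ, h1,
    Finset.sum_range_succ, show e + m - 1 + 1 = e + m by omega] at h2
  have h3 : (q : ℤ) ^ e * (q ^ m) = q ^ e * (s + (q - 1) * D) := by
    rw [pow_add] at h2
    linear_combination h2
  have h4 := mul_left_cancel₀ (pow_ne_zero e (by positivity : (q : ℤ) ≠ 0)) h3
  have h5 : q ^ m = s + (q - 1) * D := by
    zify [hq.le]
    exact h4
  have h6 : q ^ m - 1 = (q - 1) * (m + D) := by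
    rw [h5, hs, mul_add, mul_comm m]
    omega
  rw [h6, Nat.mul_div_cancel_left _ (by omega), Nat.add_sub_cancel_left]

theorem interpolates_toFrac_iff {s : ℕ} (P : AYT F s) : Interpolates (toFrac P) ↔
    ∀ d, 1 ≤ d → m F s ≤ d → harmonicSum F d 1 s = bigPi F s d *
      substY (RatFunc.X ^ Fintype.card F ^ (d - m F s))
        (MvPolynomial.map (algebraMap F[X] (RatFunc F)) P) := by
  refine forall_congr' fun d => imp_congr_right fun _ => imp_congr_right fun _ => ?_
  constructor
  · rintro ⟨v, ⟨N, D, hD, hN, rfl⟩, hv⟩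
    have hD0 : D ≠ 0 := by rintro rfl; simp at hD
    have hD' : algebraMap (KYT F s) (KYTFrac F s) D ≠ 0 := by simpa using hD0
    rw [toFrac, eq_div_iff hD', ← map_mul] at hN
    have hN' := IsFractionRing.injective (KYT F s) (KYTFrac F s) hN
    have hDs : algebraMap (KT F s) (KTFrac F s)
        (substY (RatFunc.X ^ Fintype.card F ^ (d - m F s)) D) ≠ 0 := by simpa using hD
    rw [← hN', map_mul, map_mul, mul_div_cancel_right₀ _ hDs, ← map_mul] at hv
    exact IsFractionRing.injective (KT F s) (KTFrac F s) hv
  · intro h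
    refine ⟨_, ⟨MvPolynomial.map (algebraMap F[X] (RatFunc F)) P, 1, by simp,
      by rw [map_one, div_one, toFrac], rfl⟩, ?_⟩
    rw [map_one, map_one, div_one, h, map_mul]

theorem bigPi_ne_zero (s d : ℕ) : bigPi F s d ≠ 0 := by
  refine mul_ne_zero ?_ (Finset.prod_ne_zero_iff.2 fun i _ => ?_)
  · simpa using algebraMap_l_ne_zero F (d - 1)
  · intro h0
    have h1 := congrArg (MvPolynomial.eval fun _ => (0 : RatFunc F)) h0
    rw [aeval_b, map_zero, map_prod, Finset.prod_eq_zero_iff] at h1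
    obtain ⟨u, _, hu⟩ := h1
    rw [algebraMap_X_eq_C] at hu
    simp [RatFunc.X_ne_zero] at hu

end

/-! ### The case `s = 1`, and the theorem -/

section

variable {F : Type*} [Field F] [Fintype F]

theorem X_sub_C_ratFuncX_ne_zero {F σ : Type*} [Field F] (i : σ) :
    (MvPolynomial.X i - MvPolynomial.C RatFunc.X : MvPolynomial σ (RatFunc F)) ≠ 0 := by
  intro h
  have := congrArg (MvPolynomial.eval fun _ => (0 : RatFunc F)) h
  simp [RatFunc.X_ne_zero] at this

/-- For `s = 1` the sum `∑_{j<d} b_j(t)/l_j` telescopes. -/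
theorem harmonicSum_one_mul (d : ℕ) : harmonicSum F (d + 1) 1 1 *
    (MvPolynomial.X 0 - MvPolynomial.C RatFunc.X) =
      MvPolynomial.C ((algebraMap F[X] (RatFunc F) (l F d))⁻¹) *
        aeval (MvPolynomial.X 0 : KT F 1) (b F (d + 1)) := by
  have hF (d : ℕ) : harmonicSum F d 1 1 = ∑ j ∈ Finset.range d,
      MvPolynomial.C ((algebraMap F[X] (RatFunc F) (l F j))⁻¹) *
        aeval (MvPolynomial.X 0 : KT F 1) (b F j) := by
    rw [harmonicSum_eq_sum_carlitzSum]
    refine Finset.sum_nbij' (fun k => k 0) (fun j _ => j) ?_ ?_ ?_ ?_ ?_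
    · intro k hk; exact Fintype.mem_piFinset.1 hk 0
    · intro j hj; exact Fintype.mem_piFinset.2 fun _ => hj
    · intro k _; ext i; rw [Subsingleton.elim i 0]
    · intro j _; rfl
    · intro k hk
      have hk0 := Finset.mem_range.1 (Fintype.mem_piFinset.1 hk 0)
      rw [← carlitzSum_singleton hk0, Fin.prod_univ_one]
      rfl
  induction d with
  | zero => simp [hF, l, b]
  | succ d ih =>
    have hl : (algebraMap F[X] (RatFunc F) (l F d))⁻¹ = (RatFunc.X -
        RatFunc.X ^ Fintype.card F ^ (d + 1)) * (algebraMap F[X] (RatFunc F) (l F (d + 1)))⁻¹ := by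
      rw [l_succ, map_mul, map_sub, map_pow, RatFunc.algebraMap_X, mul_inv, mul_left_comm,
        mul_inv_cancel₀, mul_one]
      rw [← neg_sub]
      exact neg_ne_zero.2 (ratFuncX_pow_card_sub_ne_zero F d)
    have hb : aeval (MvPolynomial.X 0 : KT F 1) (b F (d + 1 + 1)) =
        aeval (MvPolynomial.X 0 : KT F 1) (b F (d + 1)) *
          (MvPolynomial.X 0 - MvPolynomial.C RatFunc.X ^ Fintype.card F ^ (d + 1)) := by
      rw [aeval_b, Finset.prod_range_succ, ← aeval_b, algebraMap_X_eq_C]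
    rw [hF, Finset.sum_range_succ, ← hF, add_mul, ih, hb, hl, map_mul, map_sub, map_pow]
    ring

theorem interpolates_one : Interpolates (1 / algebraMap (KYT F 1) (KYTFrac F 1)
    (MvPolynomial.X (some 0) - MvPolynomial.C RatFunc.X)) := by
  intro d hd _
  have hm : m F 1 = 0 := by simp [m]
  have hs (c : RatFunc F) :
      substY c (MvPolynomial.X (some 0) - MvPolynomial.C RatFunc.X : KYT F 1) =
      MvPolynomial.X 0 - MvPolynomial.C RatFunc.X := by
    simp [substY]
  refine ⟨_, ⟨1, MvPolynomial.X (some 0) - MvPolynomial.C RatFunc.X, by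
    rw [hs]
    exact X_sub_C_ratFuncX_ne_zero 0,
    by rw [map_one], rfl⟩, ?_⟩
  have h0' : algebraMap (KT F 1) (KTFrac F 1)
      (MvPolynomial.X 0 - MvPolynomial.C RatFunc.X) ≠ 0 :=
    (map_ne_zero_iff _ (IsFractionRing.injective _ _)).2 (X_sub_C_ratFuncX_ne_zero 0)
  obtain ⟨d, rfl⟩ := Nat.exists_eq_add_of_le' hd
  rw [hs, map_one, map_one, ← mul_div_assoc, mul_one, eq_div_iff h0', ← map_mul,
    harmonicSum_one_mul, bigPi, hm]
  simp

end

end HarmonicSums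

end

theorem theorem1p1 {F : Type*} [Field F] [Fintype F] (s : ℕ) (hs : 1 ≤ s)
    (hmod : s ≡ 1 [MOD Fintype.card F - 1]) :
    ∃ H : HarmonicSums.KYTFrac F s,
      H ≠ 0 ∧
      HarmonicSums.Interpolates H ∧
      (s = 1 → ∀ i : Fin s,
        H = 1 / algebraMap (HarmonicSums.KYT F s) (HarmonicSums.KYTFrac F s)
          (MvPolynomial.X (some i) - MvPolynomial.C RatFunc.X)) ∧
      (0 < HarmonicSums.m F s →
        ∃ P : HarmonicSums.AYT F s,
          H = HarmonicSums.toFrac P ∧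
          (∀ i : Fin s, MvPolynomial.degreeOf (some i) P = HarmonicSums.m F s - 1) ∧
          MvPolynomial.degreeOf none P =
            (Fintype.card F ^ HarmonicSums.m F s - 1) / (Fintype.card F - 1)
              - HarmonicSums.m F s ∧
          ∀ P' : HarmonicSums.AYT F s,
            HarmonicSums.Interpolates (HarmonicSums.toFrac P') → P' = P) := by
  have hq : 1 < Fintype.card F := Fintype.one_lt_card
  have hsm : s = 1 + HarmonicSums.m F s * (Fintype.card F - 1) := by
    have := Nat.div_mul_cancel ((Nat.modEq_iff_dvd' hs).1 hmod.symm)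
    rw [HarmonicSums.m]
    omega
  rcases Nat.eq_zero_or_pos (HarmonicSums.m F s) with hm | hm
  · obtain rfl : s = 1 := by rw [hm] at hsm; simpa using hsm
    refine ⟨_, ?_, HarmonicSums.interpolates_one, fun _ i => by rw [Subsingleton.elim i 0],
      fun h => absurd hm h.ne'⟩
    rw [one_div]
    exact inv_ne_zero ((map_ne_zero_iff _ (IsFractionRing.injective _ _)).2
      (HarmonicSums.X_sub_C_ratFuncX_ne_zero (some 0)))
  · obtain ⟨P, hdeg, hP⟩ := HarmonicSums.exists_interpolant F hm hsm
    -- The value at `d = m`, where `Y = θ` and the `b_{d-m}(t_i)` are `1`.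
    have hcoeff := HarmonicSums.coeff_harmonicSum (F := F) hm hsm
    have hPm := hP 0
    rw [zero_add] at hPm
    rw [hPm] at hcoeff
    have hlead : MvPolynomial.coeff
        (Finsupp.equivFunOnFinite.symm fun _ => HarmonicSums.m F s - 1)
        (HarmonicSums.substY (RatFunc.X ^ Fintype.card F ^ 0)
          (MvPolynomial.map (algebraMap F[X] (RatFunc F)) P)) ≠ 0 := by
      intro h0
      simp only [HarmonicSums.b, Finset.range_zero, Finset.prod_empty, map_one,
        Finset.prod_const_one, mul_one, MvPolynomial.coeff_C_mul, h0, mul_zero] at hcoeff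
      exact inv_ne_zero (HarmonicSums.algebraMap_l_ne_zero F _) hcoeff.symm
    have hP0 : P ≠ 0 := by
      rintro rfl
      simp at hlead
    have hint : HarmonicSums.Interpolates (HarmonicSums.toFrac P) := by
      rw [HarmonicSums.interpolates_toFrac_iff]
      intro d hd hmd
      have := hP (d - HarmonicSums.m F s)
      rwa [Nat.sub_add_cancel hmd] at this
    refine ⟨HarmonicSums.toFrac P, ?_, hint, ?_, fun _ => ⟨P, rfl, fun i => ?_,
      HarmonicSums.degreeOf_none_interpolant hm hsm hP0 hP, fun P' hP' => ?_⟩⟩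
    · intro h
      refine hP0 (HarmonicSums.map_algebraMap_injective ?_)
      rw [map_zero]
      simpa [HarmonicSums.toFrac] using h
    · rintro rfl
      simp [HarmonicSums.m] at hm
    · refine le_antisymm (hdeg i) ?_
      have h1 := MvPolynomial.monomial_le_degreeOf i (MvPolynomial.mem_support_iff.2 hlead)
      refine le_trans (by simpa using h1) ((HarmonicSums.degreeOf_substY_le _ _ i).trans ?_)
      rw [MvPolynomial.degreeOf_def, MvPolynomial.degreeOf_def,
        MvPolynomial.degrees_map_of_injective _ (RatFunc.algebraMap_injective F)]
    · rw [HarmonicSums.interpolates_toFrac_iff] at hint hP'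
      refine HarmonicSums.map_algebraMap_injective (HarmonicSums.eq_of_substY_eq
        (Set.infinite_range_of_injective (HarmonicSums.ratFuncX_pow_card_injective F)) ?_)
      rintro _ ⟨e, rfl⟩
      have h1 := hint (e + HarmonicSums.m F s) (by omega) (by omega)
      rw [hP' _ (by omega) (by omega), Nat.add_sub_cancel] at h1
      exact mul_left_cancel₀ (HarmonicSums.bigPi_ne_zero s _) h1
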